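/- Let $\mathcal P$ be a principal ideal domain. A (finite, loopless) signed multidigraph $G$ has, for each ordered pair $(u,w)$ of distinct vertices, a number $m_{uw}\ge 0$ of arcs from $u$ to $w$, with sign $\sigma(uw)\in\{1,-1\}$. Its generalized Laplacian matrix $L(G,X)$ over $\mathcal P[x_u : u\in V(G)]$ has diagonal entries $L(G,X)_{uu}=x_u$ and off-diagonal entries $L(G,X)_{uw}=-\sigma(uw)\,m_{uw}1_{\mathcal P}$. The $j$-th critical ideal $I_j(G,X)$ is the ideal of $\mathcal P[x_u : u\in V(G)]$ generated by the $j\times j$ minors of $L(G,X)$ (so $I_0(G,X)=\langle 1\rangle$, and $I_j(G,X)=\langle 0\rangle$ for $j>|V(G)|$), and the algebraic co-rank $\gamma_{\mathcal P}(G)$ is the largest $j$ with $I_j(G,X)=\langle 1\rangle$. For $v\in V(G)$ and $K\ge 0$ let $r^K(G,v)$ be obtained from $G$ by adding $K$ new vertices $v^1,\dots,v^K$, each having the same arcs (with the same multiplicities and signs) to and from every vertex $u\ne v$ of $G$ as $v=v^0$ has, together with one arc of sign $+1$ from $v^a$ to $v^b$ for all $0\le a\neq b\le K$; write $r(G,v)=r^1(G,v)$.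 For $l\ge 0$ put \[ \widetilde P^{K}_{l}(v)=\Big\{\prod_{c\in C}(x_{v^c}+1) : C\subseteq\{0,1,\dots,K\},\ |C|=l\Big\}, \] so that $\widetilde P^{K}_0(v)=\{1\}$. Let $I_j(G,X)|_{x_v=-1}$ denote the image of $I_j(G,X)$ under the substitution $x_v=-1$. **Theorem.** Let $G$ be a signed multidigraph and $v\in V(G)$. Put $\gamma_r=\gamma_{\mathcal P}(r(G,v))$ and $\gamma_v=\gamma_{\mathcal P}(G-v)$, and let $\lambda=0$ if $\gamma_v=\gamma_r$ and $\lambda=1$ otherwise. If $\gamma_{\mathcal P}(G)\ge 2$, then $0\le\gamma_r-\gamma_v\le 2$ and, for all $k\ge 1$ and $i\ge 0$, \[ I_{\gamma_r+k}\big(r^{k+\lambda+i}(G,v),X\big)=\Big\langle \bigcup_{l=0}^{k}\widetilde P^{\,k+\lambda+i}_{l}(v)\cdot I_{\gamma_r+k-l}(G,X)|_{x_v=-1}\Big\rangle \] as ideals of the polynomial ring over $\mathcal P$ in the variables of $r^{k+\lambda+i}(G,v)$. -/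

import Mathlib

open scoped Pointwise

/-- A (loopless) signed multidigraph on the vertex set `V`: `mult u w` is the number of arcs from
`u` to `w`, and `sign u w` is the sign of these arcs (irrelevant if there are none). -/
structure SignedMultidigraph (V : Type*) where
  mult : V → V → ℕ
  sign : V → V → ℤˣ
  mult_self : ∀ u, mult u u = 0

namespace SignedMultidigraph

/-- The graph `G - v`. -/
def deleteVertex {V : Type*} (G : SignedMultidigraph V) (v : V) :
    SignedMultidigraph {u : V // u ≠ v} where
  mult u w := G.mult u w
  sign u w := G.sign u w
  mult_self u := G.mult_self u

/-- The map sending every vertex of `r^K(G, v)` to the vertex of `G` of which it is a copy. -/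
def original {V : Type*} (v : V) (K : ℕ) : V ⊕ Fin K → V :=
  Sum.elim id (fun _ => v)

/-- The copies `v^0 = v, v^1, ..., v^K` of `v` in `r^K(G, v)`. -/
def copy {V : Type*} (v : V) (K : ℕ) (c : Fin (K + 1)) : V ⊕ Fin K :=
  Fin.cases (Sum.inl v) Sum.inr c

/-- The graph `r^K(G, v)` obtained by replicating `K` times the vertex `v`: the new vertices are
`Sum.inr c`, each one has the same arcs (with multiplicities and signs) to and from the vertices
other than `v` as `v` has, and there is one positive arc from every copy of `v` to every other copy.
The graph `r(G, v)` is the case `K = 1`. -/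
def replicate {V : Type*} [DecidableEq V] (G : SignedMultidigraph V) (v : V) (K : ℕ) :
    SignedMultidigraph (V ⊕ Fin K) where
  mult p q :=
    if p = q then 0
    else if original v K p = original v K q then 1
    else G.mult (original v K p) (original v K q)
  sign p q :=
    if original v K p = original v K q then 1
    else G.sign (original v K p) (original v K q)
  mult_self p := if_pos rfl

/-- The generalized Laplacian matrix `L(G, X)` over `P[X]`. -/
noncomputable def genLaplacian (P : Type*) [CommRing P] {V : Type*} [DecidableEq V]
    (G : SignedMultidigraph V) : Matrix V V (MvPolynomial V P) :=
  fun u w =>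
    if u = w then MvPolynomial.X u
    else MvPolynomial.C (-(((G.sign u w : ℤ) : P) * (G.mult u w : P)))

/-- The critical ideal `I_j(G, X)`, generated by the determinants of the `j × j` submatrices of
`L(G, X)`. It is the unit ideal for `j = 0` and the zero ideal for `j > |V|`. -/
noncomputable def criticalIdeal (P : Type*) [CommRing P] {V : Type*} [DecidableEq V]
    (G : SignedMultidigraph V) (j : ℕ) : Ideal (MvPolynomial V P) :=
  Ideal.span {d | ∃ f g : Fin j ↪ V, d = ((genLaplacian P G).submatrix f g).det}

/-- The algebraic co-rank `γ_P(G)`: the maximum `j` for which `I_j(G, X)` is trivial. -/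
noncomputable def coRank (P : Type*) [CommRing P] {V : Type*} [DecidableEq V]
    (G : SignedMultidigraph V) : ℕ :=
  sSup {j : ℕ | criticalIdeal P G j = ⊤}

/-- The evaluation `x_v = a`, the other variables being kept. -/
noncomputable def evalVar {P : Type*} [CommRing P] {V : Type*} [DecidableEq V] (v : V) (a : P) :
    MvPolynomial V P →ₐ[P] MvPolynomial V P :=
  MvPolynomial.aeval (Function.update MvPolynomial.X v (MvPolynomial.C a))

/-- The evaluated critical ideal `I_j(G, X)|_{x_v = -1}`, generated inside the polynomial ring of
`r^K(G, v)`. -/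
noncomputable def evalCriticalIdeal (P : Type*) [CommRing P] {V : Type*} [DecidableEq V]
    (G : SignedMultidigraph V) (v : V) (K j : ℕ) : Ideal (MvPolynomial (V ⊕ Fin K) P) :=
  ((criticalIdeal P G j).map (evalVar v (-1 : P))).map
    (MvPolynomial.rename (Sum.inl : V → V ⊕ Fin K) : _ →ₐ[P] _)

/-- The set of products of `l` of the factors `x_{v^c} + 1`, where `0 ≤ c ≤ K`. -/
def replicaProducts (P : Type*) [CommRing P] {V : Type*} (v : V) (K l : ℕ) :
    Set (MvPolynomial (V ⊕ Fin K) P) :=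
  {p | ∃ C : Finset (Fin (K + 1)), C.card = l ∧
    p = ∏ c ∈ C, (MvPolynomial.X (copy v K c) + 1)}

/-- The constant `λ(r, s)`. -/
def lam (r s : ℕ) : ℕ := if r = s then 0 else 1

end SignedMultidigraph

/-!
At `x_v = -1` the vertex `v` looks like its own twin: the Laplacian of `r^K(G, v)` is the Laplacian
`B` of `G` at `x_v = -1` with the row and the column of `v` repeated, plus `x_{v^c} + 1` at the
diagonal position of each copy `v^c`.

Expanding minors along these extra diagonal terms gives products of factors `x_{v^c} + 1` times
minors of `B`. Setting every `x_{v^c}` to `-1` shows that the minors of `B` of size `γ_r` generate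
the unit ideal, so products of more than `k` factors can be discarded. Conversely, the rows of two
copies `v^c`, `v^d` differ only in the columns `v^c` and `v^d`, so for a minor using neither of
these columns, `x_{v^c} + 1` times the minor is a difference of two minors with one more row and
column. Lifting a minor of `B` that uses the column of `v` occupies a further copy of `v`; hence
the extra replica, unless `γ_v = γ_r`, when the minors avoiding `v` already generate the unit
ideal.
-/

open MvPolynomial Matrix

section MinorIdeal

variable {R S m n ι : Type*} [CommRing R] [CommRing S]

/-- The ideal generated by the `j × j` minors of a matrix. Repeated rows or columns are allowed, as
they only contribute zero generators. -/
def minorIdeal (A : Matrix m n R) (j : ℕ) : Ideal R :=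
  Ideal.span {d | ∃ (f : Fin j → m) (g : Fin j → n), d = (A.submatrix f g).det}

theorem det_submatrix_mem_minorIdeal (A : Matrix m n R) {j : ℕ} (f : Fin j → m) (g : Fin j → n) :
    (A.submatrix f g).det ∈ minorIdeal A j :=
  Ideal.subset_span ⟨f, g, rfl⟩

theorem minorIdeal_le_iff {A : Matrix m n R} {j : ℕ} {I : Ideal R} :
    minorIdeal A j ≤ I ↔ ∀ (f : Fin j → m) (g : Fin j → n), (A.submatrix f g).det ∈ I := by
  rw [minorIdeal, Ideal.span_le]
  exact ⟨fun h f g => h ⟨f, g, rfl⟩, by rintro h _ ⟨f, g, rfl⟩; exact h f g⟩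

theorem minorIdeal_le_iff_of_injective {A : Matrix m n R} {j : ℕ} {I : Ideal R} :
    minorIdeal A j ≤ I ↔ ∀ (f : Fin j → m) (g : Fin j → n), Function.Injective f →
      Function.Injective g → (A.submatrix f g).det ∈ I := by
  refine minorIdeal_le_iff.trans ⟨fun h f g _ _ => h f g, fun h f g => ?_⟩
  by_cases hf : Function.Injective f
  · by_cases hg : Function.Injective g
    · exact h f g hf hg
    · obtain ⟨a, b, hab, hne⟩ := Function.not_injective_iff.1 hg
      rw [det_zero_of_column_eq hne fun k => by simp only [submatrix_apply, hab]]
      exact zero_mem I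
  · obtain ⟨a, b, hab, hne⟩ := Function.not_injective_iff.1 hf
    rw [det_zero_of_row_eq hne (by ext k; simp only [submatrix_apply, hab])]
    exact zero_mem I

theorem minorIdeal_eq_span_embedding (A : Matrix m n R) (j : ℕ) :
    minorIdeal A j =
      Ideal.span {d | ∃ (f : Fin j ↪ m) (g : Fin j ↪ n), d = (A.submatrix f g).det} := by
  apply le_antisymm
  · exact minorIdeal_le_iff_of_injective.2 fun f g hf hg =>
      Ideal.subset_span ⟨⟨f, hf⟩, ⟨g, hg⟩, rfl⟩
  · refine Ideal.span_mono ?_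
    rintro _ ⟨f, g, rfl⟩
    exact ⟨f, g, rfl⟩

@[simp]
theorem minorIdeal_zero (A : Matrix m n R) : minorIdeal A 0 = ⊤ := by
  rw [Ideal.eq_top_iff_one, ← det_isEmpty (A := A.submatrix Fin.elim0 Fin.elim0)]
  exact det_submatrix_mem_minorIdeal A _ _

theorem minorIdeal_eq_bot_of_card_lt [Finite m] (A : Matrix m n R) {j : ℕ} (hj : Nat.card m < j) :
    minorIdeal A j = ⊥ := by
  refine le_bot_iff.1 (minorIdeal_le_iff_of_injective.2 fun f _ hf _ => absurd hj ?_)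
  simpa using Nat.card_le_card_of_injective f hf

theorem minorIdeal_submatrix_le {m' n' : Type*} (A : Matrix m n R) (r : m' → m) (s : n' → n)
    (j : ℕ) : minorIdeal (A.submatrix r s) j ≤ minorIdeal A j :=
  minorIdeal_le_iff.2 fun f g => det_submatrix_mem_minorIdeal A (r ∘ f) (s ∘ g)

theorem minorIdeal_transpose_le (A : Matrix m n R) (j : ℕ) : minorIdeal Aᵀ j ≤ minorIdeal A j :=
  minorIdeal_le_iff.2 fun f g => by
    rw [← transpose_submatrix, det_transpose]
    exact det_submatrix_mem_minorIdeal A g f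

theorem minorIdeal_transpose (A : Matrix m n R) (j : ℕ) : minorIdeal Aᵀ j = minorIdeal A j :=
  le_antisymm (minorIdeal_transpose_le A j) (minorIdeal_transpose_le Aᵀ j)

theorem map_minorIdeal {F : Type*} [FunLike F R S] [RingHomClass F R S] (φ : F)
    (A : Matrix m n R) (j : ℕ) : (minorIdeal A j).map φ = minorIdeal (A.map φ) j := by
  have det_map (f : Fin j → m) (g : Fin j → n) :
      φ (A.submatrix f g).det = ((A.map φ).submatrix f g).det :=
    RingHom.map_det (φ : R →+* S) _
  rw [minorIdeal, minorIdeal, Ideal.map_span]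
  congr 1
  ext d
  constructor
  · rintro ⟨_, ⟨f, g, rfl⟩, rfl⟩
    exact ⟨f, g, det_map f g⟩
  · rintro ⟨f, g, rfl⟩
    exact ⟨_, ⟨f, g, rfl⟩, det_map f g⟩

theorem adjugate_submatrix_mem_minorIdeal (A : Matrix m n R) {j : ℕ} (f : Fin j → m)
    (g : Fin j → n) (k i : Fin j) : adjugate (A.submatrix f g) k i ∈ minorIdeal A (j - 1) := by
  obtain _ | j := j
  · exact i.elim0
  · rw [adjugate_fin_succ_eq_det_submatrix, submatrix_submatrix]
    exact Ideal.mul_mem_left _ _ (det_submatrix_mem_minorIdeal A _ _)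

theorem minorIdeal_le_delete_row (A : Matrix m n R) (v : m) (j : ℕ) :
    minorIdeal A j ≤ minorIdeal (A.submatrix (Subtype.val : {u // u ≠ v} → m) id) (j - 1) := by
  obtain _ | j := j
  · simp
  refine minorIdeal_le_iff_of_injective.2 fun f g hf _ => ?_
  obtain ⟨i, hi⟩ : ∃ i : Fin (j + 1), ∀ a, f (i.succAbove a) ≠ v := by
    by_cases h : ∃ i, f i = v
    · obtain ⟨i, rfl⟩ := h
      exact ⟨i, fun a ha => Fin.succAbove_ne i a (hf ha)⟩
    · exact ⟨0, fun a ha => h ⟨_, ha⟩⟩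
  rw [det_succ_row _ i]
  refine Ideal.sum_mem _ fun k _ => Ideal.mul_mem_left _ _ ?_
  exact det_submatrix_mem_minorIdeal (A.submatrix (Subtype.val : {u // u ≠ v} → m) id)
    (fun a => ⟨f (i.succAbove a), hi a⟩) (g ∘ k.succAbove)

theorem minorIdeal_le_delete_col (A : Matrix m n R) (v : n) (j : ℕ) :
    minorIdeal A j ≤ minorIdeal (A.submatrix id (Subtype.val : {u // u ≠ v} → n)) (j - 1) := by
  rw [← minorIdeal_transpose A, ← minorIdeal_transpose (A.submatrix _ _)]
  exact minorIdeal_le_delete_row Aᵀ v j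

theorem minorIdeal_le_delete_row_col (A : Matrix m n R) (v : m) (w : n) (j : ℕ) :
    minorIdeal A j ≤ minorIdeal (A.submatrix (Subtype.val : {u // u ≠ v} → m)
      (Subtype.val : {u // u ≠ w} → n)) (j - 2) :=
  (minorIdeal_le_delete_row A v j).trans (minorIdeal_le_delete_col _ w (j - 1))

theorem det_add_single [Fintype n] [DecidableEq n] (A : Matrix n n R) (i k : n) (y : R) :
    (A + single i k y).det = A.det + y * adjugate A k i := by
  have row_add : A + single i k y = A.updateRow i (A i + y • Pi.single k 1) := by
    ext a b
    obtain rfl | ha := eq_or_ne a i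
    · simp [single_apply, Pi.single_apply, eq_comm]
    · simp [ha, ha.symm]
  rw [row_add, det_updateRow_add, det_updateRow_smul, updateRow_eq_self, adjugate_apply]

theorem minorIdeal_add_single_le [DecidableEq m] [DecidableEq n] (A : Matrix m n R) (p : m) (q : n)
    (y : R) (j : ℕ) :
    minorIdeal (A + single p q y) j ≤ minorIdeal A j ⊔ Ideal.span {y} * minorIdeal A (j - 1) := by
  refine minorIdeal_le_iff_of_injective.2 fun f g hf hg => ?_
  by_cases hpq : ∃ i k, f i = p ∧ g k = q
  · obtain ⟨i, k, rfl, rfl⟩ := hpq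
    have : (A + single (f i) (g k) y).submatrix f g = A.submatrix f g + single i k y := by
      ext a b
      simp [single_apply, hf.eq_iff, hg.eq_iff]
    rw [this, det_add_single]
    exact Submodule.add_mem_sup (det_submatrix_mem_minorIdeal A f g)
      (Ideal.mul_mem_mul (Ideal.mem_span_singleton_self y)
        (adjugate_submatrix_mem_minorIdeal A f g k i))
  · have : (A + single p q y).submatrix f g = A.submatrix f g := by
      ext a b
      have : ¬(p = f a ∧ q = g b) := fun h => hpq ⟨a, b, h.1.symm, h.2.symm⟩
      simp [this]
    rw [this]
    exact Submodule.mem_sup_left (det_submatrix_mem_minorIdeal A f g)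

-- Where `j < #C` the truncated `j - #C` is `0`, but such a term lies below that of any `C' ⊆ C`
-- with `j` elements.
theorem minorIdeal_add_sum_single_le [DecidableEq m] [DecidableEq n] (A : Matrix m n R)
    (p : ι → m) (q : ι → n) (y : ι → R) (D : Finset ι) (j : ℕ) :
    minorIdeal (A + ∑ c ∈ D, single (p c) (q c) (y c)) j ≤
      ⨆ C ⊆ D, Ideal.span {∏ c ∈ C, y c} * minorIdeal A (j - C.card) := by
  classical
  induction D using Finset.induction_on generalizing j with
  | empty => exact le_iSup₂_of_le ∅ subset_rfl (by simp [Ideal.span_singleton_one, Ideal.top_mul])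
  | insert c D hc ih =>
    rw [Finset.sum_insert hc, add_left_comm, add_comm (single _ _ _)]
    refine (minorIdeal_add_single_le _ (p c) (q c) (y c) j).trans (sup_le ?_ ?_)
    · exact (ih j).trans (iSup_mono fun C =>
        iSup_mono' fun hC => ⟨hC.trans (Finset.subset_insert c D), le_rfl⟩)
    · refine (Ideal.mul_mono_right (ih (j - 1))).trans ?_
      simp only [Ideal.mul_iSup]
      refine iSup₂_le fun C hC => le_iSup₂_of_le (insert c C) (Finset.insert_subset_insert c hC) ?_
      have hcC : c ∉ C := fun h => hc (hC h)
      rw [← mul_assoc, Ideal.span_singleton_mul_span_singleton, ← Finset.prod_insert hcC,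
        Finset.card_insert_of_notMem hcC, Nat.sub_sub, add_comm 1]

/-- Subtracting row `r₀` from row `r` leaves the single entry `y` in column `s`. -/
theorem mul_det_submatrix_eq_sub (M : Matrix m n R) {j : ℕ} (f : Fin j → m) (g : Fin j → n)
    (r r₀ : m) (s : n) (y : R) (hs : M r s = M r₀ s + y) (hg : ∀ a, M r (g a) = M r₀ (g a)) :
    y * (M.submatrix f g).det =
      (M.submatrix (Fin.cons r f : Fin (j + 1) → m) (Fin.cons s g : Fin (j + 1) → n)).det -
      (M.submatrix (Fin.cons r₀ f : Fin (j + 1) → m) (Fin.cons s g : Fin (j + 1) → n)).det := by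
  have row_sub :
      M.submatrix (Fin.cons r f : Fin (j + 1) → m) (Fin.cons s g : Fin (j + 1) → n) =
        M.submatrix (Fin.cons r₀ f : Fin (j + 1) → m) (Fin.cons s g : Fin (j + 1) → n) +
          single 0 0 y := by
    ext a b
    refine Fin.cases ?_ (fun a => ?_) a <;> refine Fin.cases ?_ (fun b => ?_) b <;>
      simp [hs, hg, (Fin.succ_ne_zero _).symm]
  rw [row_sub, det_add_single, add_sub_cancel_left, adjugate_fin_succ_eq_det_submatrix,
    submatrix_submatrix]
  simp [Function.comp_def]

theorem prod_mul_det_submatrix_mem_minorIdeal (M : Matrix m n R) (r₀ : m) (r : ι → m) (s : ι → n)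
    (y : ι → R) (C : Finset ι) (hdiag : ∀ c ∈ C, M (r c) (s c) = M r₀ (s c) + y c)
    (hoff : ∀ c ∈ C, ∀ d ∈ C, c ≠ d → M (r c) (s d) = M r₀ (s d))
    {j : ℕ} (f : Fin j → m) (g : Fin j → n) (hg : ∀ c ∈ C, ∀ a, M (r c) (g a) = M r₀ (g a)) :
    (∏ c ∈ C, y c) * (M.submatrix f g).det ∈ minorIdeal M (j + C.card) := by
  classical
  induction C using Finset.induction_on generalizing j with
  | empty => simpa using det_submatrix_mem_minorIdeal M f g
  | insert c C hc ih =>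
    simp only [Finset.forall_mem_insert] at hdiag hoff hg
    have lift (p : m) : (∏ c ∈ C, y c) *
        (M.submatrix (Fin.cons p f : Fin (j + 1) → m) (Fin.cons (s c) g : Fin (j + 1) → n)).det ∈
          minorIdeal M (j + 1 + C.card) :=
      ih hdiag.2 (fun d hd => (hoff.2 d hd).2) _ _ fun d hd =>
        Fin.cases ((hoff.2 d hd).1 (ne_of_mem_of_not_mem hd hc)) (hg.2 d hd)
    rw [Finset.prod_insert hc, mul_right_comm, mul_comm,
      mul_det_submatrix_eq_sub M f g (r c) r₀ (s c) (y c) hdiag.1 hg.1, mul_sub,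
      Finset.card_insert_of_notMem hc, add_comm C.card, ← add_assoc]
    exact Ideal.sub_mem _ (lift (r c)) (lift r₀)

end MinorIdeal

namespace SignedMultidigraph

section Inflate

variable {V R : Type*} {v : V} {K : ℕ}

theorem copy_injective (v : V) (K : ℕ) : Function.Injective (copy v K) := by
  intro c d
  refine Fin.cases ?_ (fun c => ?_) c <;> refine Fin.cases ?_ (fun d => ?_) d <;> simp [copy]

@[simp]
theorem original_copy (v : V) (K : ℕ) (c : Fin (K + 1)) : original v K (copy v K c) = v :=
  Fin.cases rfl (fun _ => rfl) c

theorem inl_ne_copy {u : V} (hu : u ≠ v) (c : Fin (K + 1)) : Sum.inl u ≠ copy v K c :=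
  fun h => hu ((congrArg (original v K) h).trans (original_copy v K c))

theorem original_eq_of_ne {p q : V ⊕ Fin K} (hpq : p ≠ q) (h : original v K p = original v K q) :
    original v K q = v := by
  rcases p with u | a <;> rcases q with w | b <;> simp_all [original]

theorem eq_copy_or_eq_inl (v : V) (K : ℕ) (p : V ⊕ Fin K) :
    (∃ c, p = copy v K c) ∨ ∃ u, u ≠ v ∧ p = Sum.inl u := by
  rcases p with u | a
  · by_cases hu : u = v
    · exact Or.inl ⟨0, congrArg Sum.inl hu⟩
    · exact Or.inr ⟨u, hu, rfl⟩
  · exact Or.inl ⟨a.succ, rfl⟩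

variable [DecidableEq V]

/-- The vertex of `r^K(G, v)` lying over `u`, where the copy `v^d` is chosen over `v`. -/
def liftVertex (v : V) (K : ℕ) (d : Fin (K + 1)) : V → V ⊕ Fin K :=
  Function.update Sum.inl v (copy v K d)

theorem original_comp_liftVertex (v : V) (d : Fin (K + 1)) :
    original v K ∘ liftVertex v K d = id := by
  ext u
  obtain rfl | hu := eq_or_ne u v
  · simp [liftVertex]
  · simp [liftVertex, hu, original]

theorem liftVertex_ne_copy {c d : Fin (K + 1)} (hcd : c ≠ d) (u : V) :
    liftVertex v K d u ≠ copy v K c := by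
  obtain rfl | hu := eq_or_ne u v
  · simpa [liftVertex] using fun h => hcd (copy_injective u K h).symm
  · simpa [liftVertex, hu] using inl_ne_copy hu c

variable [CommRing R]

/-- The matrix analogue of `r^K(G, v)`: the row and the column of `v` are repeated `K` times, and
`y c` is added to the diagonal entry of the copy `v^c`. -/
def inflate (B : Matrix V V R) (v : V) (K : ℕ) (y : Fin (K + 1) → R) :
    Matrix (V ⊕ Fin K) (V ⊕ Fin K) R :=
  B.submatrix (original v K) (original v K) + ∑ c, single (copy v K c) (copy v K c) (y c)

variable (B : Matrix V V R) (y : Fin (K + 1) → R)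

theorem inflate_apply {p q : V ⊕ Fin K} (h : ∀ c, p = copy v K c → q ≠ copy v K c) :
    inflate B v K y p q = B (original v K p) (original v K q) := by
  rw [inflate, Matrix.add_apply, Matrix.sum_apply, Finset.sum_eq_zero, add_zero, submatrix_apply]
  exact fun c _ => single_apply_of_ne _ _ _ _ _ fun hc => h c hc.1.symm hc.2.symm

theorem inflate_apply_copy_self (c : Fin (K + 1)) :
    inflate B v K y (copy v K c) (copy v K c) = B v v + y c := by
  simp [inflate, Matrix.sum_apply, single_apply, (copy_injective v K).eq_iff]

theorem inflate_apply_copy_of_ne {c : Fin (K + 1)} {q : V ⊕ Fin K} (h : q ≠ copy v K c) :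
    inflate B v K y (copy v K c) q = B v (original v K q) := by
  rw [inflate_apply B y fun d hd => copy_injective v K hd ▸ h, original_copy]

theorem minorIdeal_inflate_zero_le (j : ℕ) :
    minorIdeal (inflate B v K 0) j ≤ minorIdeal B j := by
  simpa [inflate] using minorIdeal_submatrix_le B (original v K) (original v K) j

theorem minorIdeal_inflate_le (j : ℕ) :
    minorIdeal (inflate B v K y) j ≤
      ⨆ C : Finset (Fin (K + 1)), Ideal.span {∏ c ∈ C, y c} * minorIdeal B (j - C.card) :=
  (minorIdeal_add_sum_single_le _ (copy v K) (copy v K) y Finset.univ j).trans <|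
    iSup₂_le fun C _ => le_iSup_of_le C <|
      Ideal.mul_mono_right (minorIdeal_submatrix_le B _ _ _)

theorem prod_mul_det_submatrix_mem_minorIdeal_inflate {d : Fin (K + 1)} {C : Finset (Fin (K + 1))}
    (hd : d ∉ C) {j : ℕ} (f g : Fin j → V ⊕ Fin K) (hg : ∀ a, ∀ c ∈ C, g a ≠ copy v K c)
    (hgd : ∀ a, g a ≠ copy v K d) (hfg : ∀ a b c, f a = copy v K c → g b ≠ copy v K c) :
    (∏ c ∈ C, y c) * (B.submatrix (original v K ∘ f) (original v K ∘ g)).det ∈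
      minorIdeal (inflate B v K y) (j + C.card) := by
  have row_d (c : Fin (K + 1)) (hc : c ∈ C) :
      inflate B v K y (copy v K d) (copy v K c) = B v v := by
    rw [inflate_apply_copy_of_ne B y ((copy_injective v K).ne (ne_of_mem_of_not_mem hc hd)),
      original_copy]
  have lift : B.submatrix (original v K ∘ f) (original v K ∘ g) =
      (inflate B v K y).submatrix f g := by
    ext a b
    exact (inflate_apply B y (hfg a b)).symm
  rw [lift]
  refine prod_mul_det_submatrix_mem_minorIdeal _ (copy v K d) (copy v K) (copy v K) y C
    (fun c hc => ?_) (fun c _ c' hc' hne => ?_) f g fun c hc a => ?_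
  · rw [row_d c hc, inflate_apply_copy_self]
  · rw [row_d c' hc', inflate_apply_copy_of_ne B y ((copy_injective v K).ne hne.symm),
      original_copy]
  · rw [inflate_apply_copy_of_ne B y (hg a c hc), inflate_apply_copy_of_ne B y (hgd a)]

theorem span_prod_mul_minorIdeal_le_inflate {C : Finset (Fin (K + 1))} (hC : C.card < K) (j : ℕ) :
    Ideal.span {∏ c ∈ C, y c} * minorIdeal B j ≤ minorIdeal (inflate B v K y) (j + C.card) := by
  obtain ⟨d, hd, d', hd', hne⟩ := Finset.one_lt_card.1
    (show 1 < Cᶜ.card by rw [Finset.card_compl, Fintype.card_fin]; omega)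
  rw [Finset.mem_compl] at hd hd'
  rw [minorIdeal, Ideal.span_mul_span', Ideal.span_le]
  rintro _ ⟨_, rfl, _, ⟨f, g, rfl⟩, rfl⟩
  have := prod_mul_det_submatrix_mem_minorIdeal_inflate B y hd (liftVertex v K d ∘ f)
    (liftVertex v K d' ∘ g) (fun a c hc => liftVertex_ne_copy (ne_of_mem_of_not_mem hc hd') _)
    (fun a => liftVertex_ne_copy hne _) fun a b c hc => liftVertex_ne_copy ?_ _
  · rwa [← Function.comp_assoc, ← Function.comp_assoc, original_comp_liftVertex,
      original_comp_liftVertex] at this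
  · rintro rfl
    exact liftVertex_ne_copy hne.symm _ hc

theorem span_prod_mul_minorIdeal_delete_le_inflate {C : Finset (Fin (K + 1))} (hC : C.card ≤ K)
    (j : ℕ) :
    Ideal.span {∏ c ∈ C, y c} * minorIdeal (B.submatrix id (Subtype.val : {u // u ≠ v} → V)) j ≤
      minorIdeal (inflate B v K y) (j + C.card) := by
  obtain ⟨d, hd⟩ := Finset.card_pos.1
    (show 0 < Cᶜ.card by rw [Finset.card_compl, Fintype.card_fin]; omega)
  rw [Finset.mem_compl] at hd
  rw [minorIdeal, Ideal.span_mul_span', Ideal.span_le]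
  rintro _ ⟨_, rfl, _, ⟨f, g, rfl⟩, rfl⟩
  have := prod_mul_det_submatrix_mem_minorIdeal_inflate B y hd (liftVertex v K d ∘ f)
    (Sum.inl ∘ Subtype.val ∘ g) (fun a c _ => inl_ne_copy (g a).2 c)
    (fun a => inl_ne_copy (g a).2 d) fun a b c _ => inl_ne_copy (g b).2 c
  rwa [← Function.comp_assoc, original_comp_liftVertex] at this

theorem minorIdeal_inflate_add {γ k : ℕ} (hB : minorIdeal B γ = ⊤) (hk : k ≤ K)
    (hdelete : k = K → minorIdeal (B.submatrix id (Subtype.val : {u // u ≠ v} → V)) γ = ⊤) :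
    minorIdeal (inflate B v K y) (γ + k) =
      ⨆ (C : Finset (Fin (K + 1))) (_ : C.card ≤ k),
        Ideal.span {∏ c ∈ C, y c} * minorIdeal B (γ + k - C.card) := by
  apply le_antisymm
  · refine (minorIdeal_inflate_le B y (γ + k)).trans (iSup_le fun C => ?_)
    obtain hC | hC := le_or_gt C.card k
    · exact le_iSup₂_of_le C hC le_rfl
    · -- Since `minorIdeal B γ = ⊤`, any `k` of the factors already absorb the whole term.
      obtain ⟨C', hC', rfl⟩ := Finset.exists_subset_card_eq hC.le
      refine le_iSup₂_of_le C' le_rfl (Ideal.mul_le_left.trans ?_)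
      rw [Nat.add_sub_cancel, hB, Ideal.mul_top, Ideal.span_singleton_le_span_singleton]
      exact Finset.prod_dvd_prod_of_subset _ _ y hC'
  · refine iSup₂_le fun C hC => ?_
    obtain hCK | hCK := lt_or_ge C.card K
    · have := span_prod_mul_minorIdeal_le_inflate (v := v) B y hCK (γ + k - C.card)
      rwa [Nat.sub_add_cancel (by omega)] at this
    · obtain rfl : C.card = k := by omega
      have := span_prod_mul_minorIdeal_delete_le_inflate (v := v) B y hk γ
      rw [hdelete (by omega), Ideal.mul_top] at this
      exact Ideal.mul_le_left.trans this

end Inflate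

section CriticalIdeal

variable {P V S : Type*} [CommRing P] [DecidableEq V] [CommRing S] [Algebra P S]

theorem criticalIdeal_eq_minorIdeal (G : SignedMultidigraph V) (j : ℕ) :
    G.criticalIdeal P j = minorIdeal (genLaplacian P G) j :=
  (minorIdeal_eq_span_embedding _ _).symm

theorem bddAbove_setOf_criticalIdeal_eq_top [Nontrivial P] [Finite V] (G : SignedMultidigraph V) :
    BddAbove {j | G.criticalIdeal P j = ⊤} := by
  refine ⟨Nat.card V, fun j (hj : G.criticalIdeal P j = ⊤) => ?_⟩
  by_contra! hlt
  rw [criticalIdeal_eq_minorIdeal, minorIdeal_eq_bot_of_card_lt _ hlt] at hj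
  exact bot_ne_top hj

theorem le_coRank [Nontrivial P] [Finite V] {G : SignedMultidigraph V} {j : ℕ}
    (hj : G.criticalIdeal P j = ⊤) : j ≤ G.coRank P :=
  le_csSup (bddAbove_setOf_criticalIdeal_eq_top G) hj

theorem criticalIdeal_coRank [Nontrivial P] [Finite V] (G : SignedMultidigraph V) :
    G.criticalIdeal P (G.coRank P) = ⊤ := by
  refine Nat.sSup_mem ⟨0, ?_⟩ (bddAbove_setOf_criticalIdeal_eq_top G)
  exact (criticalIdeal_eq_minorIdeal G 0).trans (minorIdeal_zero _)

/-- The generalized Laplacian matrix evaluated at the point `z` of a `P`-algebra. -/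
noncomputable def laplacianAt (P : Type*) [CommRing P] [Algebra P S] (G : SignedMultidigraph V)
    (z : V → S) : Matrix V V S :=
  (genLaplacian P G).map (aeval z : MvPolynomial V P →ₐ[P] S)

theorem laplacianAt_apply (G : SignedMultidigraph V) (z : V → S) (u w : V) :
    laplacianAt P G z u w = if u = w then z u
      else algebraMap P S (-(((G.sign u w : ℤ) : P) * (G.mult u w : P))) := by
  rw [laplacianAt, map_apply, genLaplacian]
  split_ifs
  · exact aeval_X z u
  · exact aeval_C z _

theorem laplacianAt_X (G : SignedMultidigraph V) :
    laplacianAt P G (X : V → MvPolynomial V P) = genLaplacian P G := by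
  ext1 u w
  rw [laplacianAt_apply, genLaplacian, algebraMap_eq]

theorem minorIdeal_laplacianAt_eq_top {G : SignedMultidigraph V} {j : ℕ}
    (hj : G.criticalIdeal P j = ⊤) (z : V → S) : minorIdeal (laplacianAt P G z) j = ⊤ := by
  rw [laplacianAt, ← map_minorIdeal, ← criticalIdeal_eq_minorIdeal, hj, Ideal.map_top]

theorem laplacianAt_deleteVertex (G : SignedMultidigraph V) (v : V) (z : V → S) :
    laplacianAt P (G.deleteVertex v) (z ∘ Subtype.val) =
      (laplacianAt P G z).submatrix Subtype.val Subtype.val := by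
  ext u w
  simp [laplacianAt_apply, deleteVertex, Subtype.ext_iff]

theorem laplacianAt_replicate (G : SignedMultidigraph V) {v : V} {K : ℕ} {z : V → S}
    {x : V ⊕ Fin K → S} (hv : z v = -1) (hx : ∀ u ≠ v, x (Sum.inl u) = z u) :
    laplacianAt P (G.replicate v K) x =
      inflate (laplacianAt P G z) v K fun c => x (copy v K c) + 1 := by
  ext p q
  obtain rfl | hpq := eq_or_ne p q
  · obtain ⟨c, rfl⟩ | ⟨u, hu, rfl⟩ := eq_copy_or_eq_inl v K p
    · simp [inflate_apply_copy_self, laplacianAt_apply, hv]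
    · rw [inflate_apply _ _ fun c hc => absurd hc (inl_ne_copy hu c)]
      simp [laplacianAt_apply, original, hx u hu]
  · rw [inflate_apply _ _ fun c hc hc' => hpq (hc.trans hc'.symm)]
    rw [laplacianAt_apply, if_neg hpq, laplacianAt_apply]
    by_cases h : original v K p = original v K q
    · have hq : original v K q = v := original_eq_of_ne hpq h
      simp [replicate, hpq, h, hq, hv]
    · simp [replicate, hpq, h]

theorem minorIdeal_laplacianAt_eq_top_of_replicate {G : SignedMultidigraph V} {v : V} {K j : ℕ}
    (hj : (G.replicate v K).criticalIdeal P j = ⊤) {z : V → S} (hv : z v = -1) :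
    minorIdeal (laplacianAt P G z) j = ⊤ := by
  have hinflate : laplacianAt P (G.replicate v K) (z ∘ original v K) =
      inflate (laplacianAt P G z) v K 0 := by
    rw [laplacianAt_replicate G hv fun _ _ => rfl]
    congr
    ext c
    simp [hv]
  rw [← top_le_iff, ← minorIdeal_laplacianAt_eq_top hj (z ∘ original v K), hinflate]
  exact minorIdeal_inflate_zero_le _ j

theorem minorIdeal_laplacianAt_delete_col_eq_top {G : SignedMultidigraph V} {v : V} {j : ℕ}
    (hj : (G.deleteVertex v).criticalIdeal P j = ⊤) (z : V → S) :
    minorIdeal ((laplacianAt P G z).submatrix id (Subtype.val : {u // u ≠ v} → V)) j = ⊤ := by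
  rw [← top_le_iff, ← minorIdeal_laplacianAt_eq_top hj (z ∘ Subtype.val),
    laplacianAt_deleteVertex]
  exact minorIdeal_submatrix_le ((laplacianAt P G z).submatrix id Subtype.val) Subtype.val id j

/-- The point `x_v = -1` in the polynomial ring of `r^K(G, v)`, the variables of the other vertices
of `G` being kept. -/
noncomputable def replicaPoint (P : Type*) [CommRing P] (v : V) (K : ℕ) :
    V → MvPolynomial (V ⊕ Fin K) P :=
  Function.update (X ∘ Sum.inl) v (-1)

@[simp]
theorem replicaPoint_self (v : V) (K : ℕ) : replicaPoint P v K v = -1 :=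
  Function.update_self v (-1) _

@[simp]
theorem replicaPoint_of_ne {u v : V} (hu : u ≠ v) (K : ℕ) :
    replicaPoint P v K u = X (Sum.inl u) :=
  Function.update_of_ne hu (-1) _

theorem genLaplacian_replicate (G : SignedMultidigraph V) (v : V) (K : ℕ) :
    genLaplacian P (G.replicate v K) =
      inflate (laplacianAt P G (replicaPoint P v K)) v K fun c => X (copy v K c) + 1 := by
  rw [← laplacianAt_X]
  exact laplacianAt_replicate G (replicaPoint_self v K) fun u hu => (replicaPoint_of_ne hu K).symm

theorem evalCriticalIdeal_eq_minorIdeal (G : SignedMultidigraph V) (v : V) (K j : ℕ) :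
    G.evalCriticalIdeal P v K j = minorIdeal (laplacianAt P G (replicaPoint P v K)) j := by
  rw [evalCriticalIdeal, criticalIdeal_eq_minorIdeal, map_minorIdeal, map_minorIdeal]
  congr 1
  ext1 u w
  rw [laplacianAt_apply, map_apply, map_apply, genLaplacian, evalVar]
  split_ifs
  · obtain rfl | hu := eq_or_ne u v
    · simp
    · simp [hu]
  · simp

theorem coRank_deleteVertex_le_coRank_replicate [Nontrivial P] [Finite V]
    (G : SignedMultidigraph V) (v : V) (K : ℕ) :
    (G.deleteVertex v).coRank P ≤ (G.replicate v K).coRank P := by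
  refine le_coRank (top_le_iff.1 ?_)
  have := span_prod_mul_minorIdeal_delete_le_inflate (laplacianAt P G (replicaPoint P v K))
    (fun c => X (copy v K c) + 1) (v := v) (C := ∅) (Nat.zero_le K) ((G.deleteVertex v).coRank P)
  rwa [minorIdeal_laplacianAt_delete_col_eq_top (criticalIdeal_coRank _), Finset.prod_empty,
    Ideal.span_singleton_one, Ideal.mul_top, ← genLaplacian_replicate,
    ← criticalIdeal_eq_minorIdeal] at this

theorem coRank_replicate_le_coRank_deleteVertex_add_two [Nontrivial P] [Finite V]
    (G : SignedMultidigraph V) (v : V) (K : ℕ) :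
    (G.replicate v K).coRank P ≤ (G.deleteVertex v).coRank P + 2 := by
  let z : V → MvPolynomial {u // u ≠ v} P := fun u => if hu : u ≠ v then X ⟨u, hu⟩ else -1
  have z_val : z ∘ Subtype.val = X := funext fun u => dif_pos u.2
  have z_top : minorIdeal (laplacianAt P G z) ((G.replicate v K).coRank P) = ⊤ :=
    minorIdeal_laplacianAt_eq_top_of_replicate (criticalIdeal_coRank _)
      (dif_neg fun hv : v ≠ v => hv rfl)
  refine Nat.sub_le_iff_le_add.1 (le_coRank (top_le_iff.1 ?_))
  rw [criticalIdeal_eq_minorIdeal, ← laplacianAt_X, ← z_val, laplacianAt_deleteVertex, ← z_top]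
  exact minorIdeal_le_delete_row_col _ v v _

theorem span_iUnion_replicaProducts_mul {V : Type*} (v : V) (K k : ℕ)
    (I : ℕ → Ideal (MvPolynomial (V ⊕ Fin K) P)) :
    Ideal.span (⋃ l ∈ Finset.range (k + 1),
        replicaProducts P v K l * (I l : Set (MvPolynomial (V ⊕ Fin K) P))) =
      ⨆ (C : Finset (Fin (K + 1))) (_ : C.card ≤ k),
        Ideal.span {∏ c ∈ C, (X (copy v K c) + 1)} * I C.card := by
  apply le_antisymm
  · refine Ideal.span_le.2 (Set.iUnion₂_subset fun l hl => ?_)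
    rintro _ ⟨_, ⟨C, rfl, rfl⟩, b, hb, rfl⟩
    have hC : C.card ≤ k := Finset.mem_range_succ_iff.1 hl
    exact le_iSup₂ (f := fun (C : Finset (Fin (K + 1))) (_ : C.card ≤ k) =>
      Ideal.span {∏ c ∈ C, (X (copy v K c) + 1 : MvPolynomial (V ⊕ Fin K) P)} * I C.card) C hC
      (Ideal.mul_mem_mul (Ideal.mem_span_singleton_self _) hb)
  · refine iSup₂_le fun C hC => Ideal.span_singleton_mul_le_iff.2 fun b hb => Ideal.subset_span ?_
    exact Set.mem_biUnion (Finset.mem_coe.2 (Finset.mem_range_succ_iff.2 hC))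
      (Set.mul_mem_mul ⟨C, rfl, rfl⟩ hb)

theorem criticalIdeal_replicate_add {G : SignedMultidigraph V} {v : V} {K γ k : ℕ}
    (hG : G.evalCriticalIdeal P v K γ = ⊤) (hk : k ≤ K)
    (hdelete : k = K → (G.deleteVertex v).criticalIdeal P γ = ⊤) :
    (G.replicate v K).criticalIdeal P (γ + k) =
      Ideal.span (⋃ l ∈ Finset.range (k + 1), replicaProducts P v K l *
        (G.evalCriticalIdeal P v K (γ + k - l) : Set (MvPolynomial (V ⊕ Fin K) P))) := by
  rw [evalCriticalIdeal_eq_minorIdeal] at hG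
  rw [span_iUnion_replicaProducts_mul, criticalIdeal_eq_minorIdeal, genLaplacian_replicate,
    minorIdeal_inflate_add _ _ hG hk fun h =>
      minorIdeal_laplacianAt_delete_col_eq_top (hdelete h) _]
  simp only [evalCriticalIdeal_eq_minorIdeal]

end CriticalIdeal

end SignedMultidigraph

open SignedMultidigraph

theorem mainTheorem4_general {P : Type*} [CommRing P] [Nontrivial P]
    {V : Type*} [Finite V] [DecidableEq V] (G : SignedMultidigraph V) (v : V)
    (γ_r γ_v lam : ℕ)
    (hγ_r : γ_r = (G.replicate v 1).coRank P)
    (hγ_v : γ_v = (G.deleteVertex v).coRank P)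
    (hlam : lam = SignedMultidigraph.lam γ_v γ_r) :
    (0 ≤ (γ_r : ℤ) - (γ_v : ℤ) ∧ (γ_r : ℤ) - (γ_v : ℤ) ≤ 2) ∧
    ∀ k i : ℕ,
      (G.replicate v (k + lam + i)).criticalIdeal P (γ_r + k) =
        Ideal.span (⋃ l ∈ Finset.range (k + 1),
          replicaProducts P v (k + lam + i) l *
            (G.evalCriticalIdeal P v (k + lam + i) (γ_r + k - l) :
              Set (MvPolynomial (V ⊕ Fin (k + lam + i)) P))) := by
  have lower := coRank_deleteVertex_le_coRank_replicate (P := P) G v 1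
  have upper := coRank_replicate_le_coRank_deleteVertex_add_two (P := P) G v 1
  refine ⟨by omega, fun k i => criticalIdeal_replicate_add ?_ (by omega) fun hk => ?_⟩
  · rw [evalCriticalIdeal_eq_minorIdeal, hγ_r]
    exact minorIdeal_laplacianAt_eq_top_of_replicate (criticalIdeal_coRank _)
      (replicaPoint_self v _)
  · have hγ : γ_v = γ_r := by
      by_contra hne
      rw [SignedMultidigraph.lam, if_neg hne] at hlam
      omega
    rw [← hγ, hγ_v]
    exact criticalIdeal_coRank _

theorem mainTheorem4 {P : Type*} [CommRing P] [IsDomain P] [IsPrincipalIdealRing P]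
    {V : Type*} [Fintype V] [DecidableEq V] (G : SignedMultidigraph V) (v : V)
    (γ_r γ_v lam : ℕ)
    (hγ_r : γ_r = (G.replicate v 1).coRank P)
    (hγ_v : γ_v = (G.deleteVertex v).coRank P)
    (hlam : lam = SignedMultidigraph.lam γ_v γ_r)
    (hγ : 2 ≤ G.coRank P) :
    (0 ≤ (γ_r : ℤ) - (γ_v : ℤ) ∧ (γ_r : ℤ) - (γ_v : ℤ) ≤ 2) ∧
    ∀ k i : ℕ, 1 ≤ k →
      (G.replicate v (k + lam + i)).criticalIdeal P (γ_r + k) =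
        Ideal.span (⋃ l ∈ Finset.range (k + 1),
          SignedMultidigraph.replicaProducts P v (k + lam + i) l *
            (G.evalCriticalIdeal P v (k + lam + i) (γ_r + k - l) :
              Set (MvPolynomial (V ⊕ Fin (k + lam + i)) P))) := by
  have h := mainTheorem4_general G v γ_r γ_v lam hγ_r hγ_v hlam
  exact ⟨h.1, fun k i _ => h.2 k i⟩
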